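/- Let $R$ be any one of the following three rings, with pointwise addition and multiplication: 1. the ring $\mathbb C\langle z\rangle$ of entire functions $\mathbb C\to\mathbb C$; 2. the ring $\mathbb C\langle x\rangle$ of entire functions $f:\mathbb C\to\mathbb C$ of the form $f(z)=\sum_{n=0}^\infty a_n z^n$ with all $a_n\in\mathbb R$, the series converging for every $z\in\mathbb C$; 3. the ring $\mathbb R\langle x\rangle$ of real analytic functions $\mathbb R\to\mathbb R$, that is, functions given near each point of $\mathbb R$ by a convergent power series with real coefficients. Then every nonzero prime ideal of $R$ is contained in exactly one maximal ideal of $R$. -/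

import Mathlib

/-- The ring of entire functions of one complex variable, with pointwise operations. -/
def complexEntire : Subring (ℂ → ℂ) where
  carrier := {f | Differentiable ℂ f}
  mul_mem' := fun hf hg => Differentiable.mul hf hg
  one_mem' := differentiable_const (1 : ℂ)
  add_mem' := fun hf hg => Differentiable.add hf hg
  zero_mem' := differentiable_const (0 : ℂ)
  neg_mem' := fun hf => Differentiable.neg hf

/-- The ring of entire functions of one complex variable given by an everywhere convergent
power series with real coefficients, with pointwise operations. -/
def realCoeffEntire : Subring (ℂ → ℂ) where
  carrier := {f | ∃ a : ℕ → ℝ, ∀ z : ℂ, HasSum (fun n : ℕ => (a n : ℂ) * z ^ n) (f z)}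
  mul_mem' := by
    rintro f g ⟨a, ha⟩ ⟨b, hb⟩
    refine ⟨fun n => ∑ kl ∈ Finset.HasAntidiagonal.antidiagonal n, a kl.1 * b kl.2, fun z => ?_⟩
    have hs := summable_norm_sum_mul_antidiagonal_of_summable_norm
      (ha z).summable.norm (hb z).summable.norm
    have ht := tsum_mul_tsum_eq_tsum_sum_antidiagonal_of_summable_norm
      (ha z).summable.norm (hb z).summable.norm
    rw [(ha z).tsum_eq, (hb z).tsum_eq] at ht
    rw [Pi.mul_apply, ht]
    refine hs.of_norm.hasSum.congr_fun ?_
    intro n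
    push_cast
    rw [Finset.sum_mul]
    refine Finset.sum_congr rfl fun kl hkl => ?_
    rw [← Finset.HasAntidiagonal.mem_antidiagonal.mp hkl, pow_add]
    ring
  one_mem' := by
    refine ⟨fun n => if n = 0 then 1 else 0, fun z => ?_⟩
    have h := hasSum_single (f := fun n : ℕ => (((if n = 0 then 1 else 0 : ℝ)) : ℂ) * z ^ n) 0
      (by intro n hn; simp [hn])
    simpa using h
  add_mem' := by
    rintro f g ⟨a, ha⟩ ⟨b, hb⟩
    refine ⟨fun n => a n + b n, fun z => ?_⟩
    simpa [add_mul] using (ha z).add (hb z)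
  zero_mem' := ⟨fun _ => 0, fun z => by simp⟩
  neg_mem' := by
    rintro f ⟨a, ha⟩
    refine ⟨fun n => - a n, fun z => ?_⟩
    simpa using (ha z).neg

/-- The ring of real analytic functions on the real line, with pointwise operations. -/
def realAnalytic : Subring (ℝ → ℝ) where
  carrier := {f | ∀ x : ℝ, AnalyticAt ℝ f x}
  mul_mem' := fun hf hg x => (hf x).mul (hg x)
  one_mem' := fun _ => analyticAt_const
  add_mem' := fun hf hg x => (hf x).add (hg x)
  zero_mem' := fun _ => analyticAt_const
  neg_mem' := fun hf x => (hf x).neg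

open Filter Topology Metric

/-! If distinct maximal ideals `M`, `N` contain `P`, write `1 = g + h` with `g ∈ N`, `h ∈ M`, and
take `0 ≠ f ∈ P`. Once `f` divides `(1 - v * g) * (1 - w * (1 - g))`, primality puts a factor in
`P`, and then `N` or `M` contains `1`. Such `v`, `w` exist because `g` and `1 - g` have no common
zero: let `v` agree with `1/g`, to the order of vanishing of `f`, at the zeros of `f` where `g ≠ 0`,
and treat `w` likewise for `1 - g`. This interpolation (`exists_interpolation`) follows from
Mittag-Leffler. The real analytic case takes real parts of a complex solution; the real-coefficient
case multiplies the complex relation by its conjugate. -/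

theorem existsUnique_maximal_of_forall_dvd {R : Type*} [CommRing R]
    (H : ∀ f g : R, f ≠ 0 → ∃ v w : R, f ∣ (1 - v * g) * (1 - w * (1 - g)))
    (P : Ideal R) (hP : P.IsPrime) (hne : P ≠ ⊥) :
    ∃! M : Ideal R, M.IsMaximal ∧ P ≤ M := by
  obtain ⟨M, hM, hPM⟩ := P.exists_le_maximal hP.ne_top
  refine ⟨M, ⟨hM, hPM⟩, ?_⟩
  rintro N ⟨hN, hPN⟩
  by_contra hNM
  obtain ⟨g, hg, h, hh, hgh⟩ := Submodule.mem_sup.mp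
    ((Ideal.eq_top_iff_one _).mp (hN.coprime_of_ne hM hNM))
  obtain ⟨f, hfP, hf⟩ := Submodule.exists_mem_ne_zero_of_ne_bot hne
  obtain ⟨v, w, hvw⟩ := H f g hf
  rcases hP.mem_or_mem (P.mem_of_dvd hvw hfP) with h1 | h1
  · refine hN.ne_top ((Ideal.eq_top_iff_one _).mpr ?_)
    simpa using N.add_mem (hPN h1) (N.mul_mem_left v hg)
  · refine hM.ne_top ((Ideal.eq_top_iff_one _).mpr ?_)
    have : 1 - g = h := by rw [← hgh]; ring
    rw [this] at h1
    simpa using M.add_mem (hPM h1) (M.mul_mem_left w hh)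

/-! ### Local division and principal parts -/

section Local

variable {𝕜 : Type*} [NontriviallyNormedField 𝕜]

theorem AnalyticAt.dslope_same {f : 𝕜 → 𝕜} {b : 𝕜} (hf : AnalyticAt 𝕜 f b) :
    AnalyticAt 𝕜 (dslope f b) b :=
  let ⟨_, hp⟩ := hf
  ⟨_, hp.has_fpower_series_dslope_fslope⟩

theorem AnalyticAt.exists_polynomial_add_pow_mul {f : 𝕜 → 𝕜} {b : 𝕜} (hf : AnalyticAt 𝕜 f b)
    (m : ℕ) : ∃ (T : Polynomial 𝕜) (h : 𝕜 → 𝕜), AnalyticAt 𝕜 h b ∧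
      ∀ z, f z = T.eval z + (z - b) ^ m * h z := by
  induction m with
  | zero => exact ⟨0, f, hf, by simp⟩
  | succ m ih =>
    obtain ⟨T, h, hh, hT⟩ := ih
    refine ⟨T + Polynomial.C (h b) * (Polynomial.X - Polynomial.C b) ^ m, dslope h b,
      hh.dslope_same, fun z => ?_⟩
    have := sub_smul_dslope h b z
    rw [smul_eq_mul] at this
    simp only [Polynomial.eval_add, Polynomial.eval_mul, Polynomial.eval_C, Polynomial.eval_pow,
      Polynomial.eval_sub, Polynomial.eval_X]
    rw [hT z, pow_succ, mul_assoc, this]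
    ring

/-- Near an isolated zero `b` of `f`, the quotient `φ / f` is the sum of a principal part at `b`
and an analytic function. -/
theorem AnalyticAt.exists_principalPart {f φ : 𝕜 → 𝕜} {b : 𝕜} (hf : AnalyticAt 𝕜 f b)
    (hf0 : ∀ᶠ z in 𝓝[≠] b, f z ≠ 0) (hφ : AnalyticAt 𝕜 φ b) :
    ∃ (T : Polynomial 𝕜) (m : ℕ) (h : 𝕜 → 𝕜), AnalyticAt 𝕜 h b ∧
      ∀ᶠ z in 𝓝[≠] b, φ z = f z * (T.eval z / (z - b) ^ m + h z) := by
  have hne : ¬ ∀ᶠ z in 𝓝 b, f z = 0 := fun h0 => by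
    obtain ⟨z, h1, h2⟩ := (hf0.and (h0.filter_mono nhdsWithin_le_nhds)).exists
    exact h1 h2
  obtain ⟨m, u, hu, hub, hfu⟩ := hf.exists_eventuallyEq_pow_smul_nonzero_iff.mpr hne
  -- With `f = (z - b) ^ m * u`, the Taylor polynomial of `φ / u` is the numerator of the principal
  -- part.
  obtain ⟨T, h, hh, hT⟩ := (hφ.div hu hub).exists_polynomial_add_pow_mul m
  refine ⟨T, m, h, hh, ?_⟩
  filter_upwards [hfu.filter_mono nhdsWithin_le_nhds,
    (hu.continuousAt.eventually_ne hub).filter_mono nhdsWithin_le_nhds, self_mem_nhdsWithin]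
    with z h1 h2 h3
  have h3' : z - b ≠ 0 := sub_ne_zero.mpr h3
  have h4 := hT z
  simp only [Pi.div_apply] at h4
  rw [div_eq_iff h2] at h4
  rw [h1, h4, smul_eq_mul]
  field_simp

/-- Divisibility by a function with isolated zeros is a local property. -/
theorem exists_analytic_eq_mul_of_local {f F : 𝕜 → 𝕜}
    (hf0 : ∀ b, ∀ᶠ z in 𝓝[≠] b, f z ≠ 0)
    (H : ∀ b, ∃ h, AnalyticAt 𝕜 h b ∧ ∀ᶠ z in 𝓝 b, F z = f z * h z) :
    ∃ k : 𝕜 → 𝕜, (∀ b, AnalyticAt 𝕜 k b) ∧ ∀ z, F z = f z * k z := by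
  choose h hh hF using H
  refine ⟨fun z => h z z, fun b => (hh b).congr ?_, fun z => (hF z).self_of_nhds⟩
  have h1 : ∀ᶠ z in 𝓝[≠] b, h b z = h z z := by
    filter_upwards [hf0 b, (hF b).filter_mono nhdsWithin_le_nhds] with z h1 h2
    exact mul_left_cancel₀ h1 (h2.symm.trans (hF z).self_of_nhds)
  rw [← nhdsNE_sup_pure]
  exact eventually_sup.mpr ⟨h1, by simp⟩

theorem finite_zeros_inter_closedBall [ProperSpace 𝕜] {f : 𝕜 → 𝕜}
    (hf0 : ∀ b, ∀ᶠ z in 𝓝[≠] b, f z ≠ 0) (r : ℝ) :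
    ({z | f z = 0} ∩ closedBall 0 r).Finite := by
  by_contra hinf
  obtain ⟨b, -, hb⟩ := Set.Infinite.exists_accPt_of_subset_isCompact hinf
    (isCompact_closedBall (0 : 𝕜) r) Set.inter_subset_right
  rw [accPt_iff_frequently_nhdsNE] at hb
  obtain ⟨z, h1, h2⟩ := (hb.and_eventually (hf0 b)).exists
  exact h2 h1.1

theorem eventually_ne_zero_of_ne_zero [PreconnectedSpace 𝕜] {f : 𝕜 → 𝕜}
    (hf : ∀ z, AnalyticAt 𝕜 f z) (hne : f ≠ 0) (b : 𝕜) : ∀ᶠ z in 𝓝[≠] b, f z ≠ 0 := by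
  refine (hf b).eventually_eq_zero_or_eventually_ne_zero.resolve_left fun h => hne ?_
  exact AnalyticOnNhd.eq_of_eventuallyEq (fun z _ => hf z) (g := 0)
    (fun z _ => analyticAt_const) h

end Local

/-- The existence statement of Mittag-Leffler for a field `𝕜`. -/
def HasMittagLeffler (𝕜 : Type*) [NontriviallyNormedField 𝕜] : Prop :=
  ∀ (S : Set 𝕜), (∀ r : ℝ, (S ∩ closedBall 0 r).Finite) →
    ∀ (T : 𝕜 → Polynomial 𝕜) (m : 𝕜 → ℕ), ∃ q : 𝕜 → 𝕜,
      (∀ b ∉ S, AnalyticAt 𝕜 q b) ∧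
      ∀ b ∈ S, AnalyticAt 𝕜 (fun z => q z - (T b).eval z / (z - b) ^ m b) b

/-! ### Interpolation along the zeros of a function -/

namespace HasMittagLeffler

variable {𝕜 : Type*} [NontriviallyNormedField 𝕜] [ProperSpace 𝕜]

/-- Take `v = f * q`, where `q` has the principal part of `φ b / f` at each zero `b` of `f`; then `q
- φ b / f` extends analytically across `b`. -/
theorem exists_interpolation (H : HasMittagLeffler 𝕜) {f : 𝕜 → 𝕜} (hf : ∀ z, AnalyticAt 𝕜 f z)
    (hf0 : ∀ b, ∀ᶠ z in 𝓝[≠] b, f z ≠ 0) {φ : 𝕜 → 𝕜 → 𝕜} (hφ : ∀ b, AnalyticAt 𝕜 (φ b) b) :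
    ∃ v : 𝕜 → 𝕜, (∀ b, AnalyticAt 𝕜 v b) ∧ ∀ b, f b = 0 →
      ∃ h, AnalyticAt 𝕜 h b ∧ ∀ᶠ z in 𝓝 b, v z = φ b z + f z * h z := by
  classical
  choose T m h hh hT using fun b => (hf b).exists_principalPart (hf0 b) (hφ b)
  obtain ⟨q, hq, hqS⟩ := H {z | f z = 0} (finite_zeros_inter_closedBall hf0) T m
  -- At a zero of `f` the product `f z * q z` is `0`, so the right value is put in by hand.
  set v : 𝕜 → 𝕜 := fun z => if f z = 0 then φ z z else f z * q z with hv
  have key : ∀ b, f b = 0 → ∃ h, AnalyticAt 𝕜 h b ∧ ∀ᶠ z in 𝓝 b, v z = φ b z + f z * h z := by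
    intro b hb
    refine ⟨_, (hqS b hb).sub (hh b), ?_⟩
    rw [← nhdsNE_sup_pure]
    refine eventually_sup.mpr ⟨?_, by simp [hv, hb]⟩
    filter_upwards [hT b, hf0 b] with z h1 h2
    simp only [hv, h2, if_false, h1, Pi.sub_apply]
    ring
  refine ⟨v, fun b => ?_, key⟩
  by_cases hb : f b = 0
  · obtain ⟨k, hk, hvk⟩ := key b hb
    exact ((hφ b).add ((hf b).mul hk)).congr (hvk.mono fun z hz => hz.symm)
  · refine ((hf b).mul (hq b hb)).congr ?_
    filter_upwards [(hf b).continuousAt.eventually_ne hb] with z hz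
    simp [hv, hz]

theorem exists_local_inverse (H : HasMittagLeffler 𝕜) {f g : 𝕜 → 𝕜}
    (hf : ∀ z, AnalyticAt 𝕜 f z) (hf0 : ∀ b, ∀ᶠ z in 𝓝[≠] b, f z ≠ 0)
    (hg : ∀ z, AnalyticAt 𝕜 g z) :
    ∃ v : 𝕜 → 𝕜, (∀ b, AnalyticAt 𝕜 v b) ∧ ∀ b, g b ≠ 0 →
      ∃ h, AnalyticAt 𝕜 h b ∧ ∀ᶠ z in 𝓝 b, 1 - v z * g z = f z * h z := by
  classical
  obtain ⟨v, hv, hvf⟩ := H.exists_interpolation hf hf0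
    (φ := fun b => if g b = 0 then 0 else g⁻¹) (fun b => by
      by_cases hb : g b = 0
      · simp only [hb, if_true]
        exact analyticAt_const
      · simpa [hb] using (hg b).inv hb)
  refine ⟨v, hv, fun b hb => ?_⟩
  by_cases hfb : f b = 0
  · obtain ⟨h, hh, hvh⟩ := hvf b hfb
    refine ⟨-(h * g), (hh.mul (hg b)).neg, ?_⟩
    filter_upwards [hvh, (hg b).continuousAt.eventually_ne hb] with z h1 h2
    simp only [h1, hb, if_false, Pi.inv_apply, Pi.neg_apply, Pi.mul_apply]
    field_simp
    ring
  · refine ⟨_, ((analyticAt_const (v := (1 : 𝕜))).sub ((hv b).mul (hg b))).div (hf b) hfb, ?_⟩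
    filter_upwards [(hf b).continuousAt.eventually_ne hfb] with z h1
    simp only [Pi.div_apply, Pi.sub_apply, Pi.mul_apply]
    field_simp

theorem exists_dvd [PreconnectedSpace 𝕜] (H : HasMittagLeffler 𝕜) {f g : 𝕜 → 𝕜}
    (hf : ∀ z, AnalyticAt 𝕜 f z) (hne : f ≠ 0) (hg : ∀ z, AnalyticAt 𝕜 g z) :
    ∃ v w k : 𝕜 → 𝕜, (∀ b, AnalyticAt 𝕜 v b) ∧ (∀ b, AnalyticAt 𝕜 w b) ∧
      (∀ b, AnalyticAt 𝕜 k b) ∧ (1 - v * g) * (1 - w * (1 - g)) = f * k := by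
  have hf0 := eventually_ne_zero_of_ne_zero hf hne
  have hg' : ∀ z, AnalyticAt 𝕜 (1 - g) z := fun z => analyticAt_const.sub (hg z)
  obtain ⟨v, hv, hv'⟩ := H.exists_local_inverse hf hf0 hg
  obtain ⟨w, hw, hw'⟩ := H.exists_local_inverse hf hf0 hg'
  have hV : ∀ b, AnalyticAt 𝕜 (1 - v * g) b := fun b => analyticAt_const.sub ((hv b).mul (hg b))
  have hW : ∀ b, AnalyticAt 𝕜 (1 - w * (1 - g)) b :=
    fun b => analyticAt_const.sub ((hw b).mul (hg' b))
  obtain ⟨k, hk, hk'⟩ := exists_analytic_eq_mul_of_local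
    (F := (1 - v * g) * (1 - w * (1 - g))) hf0 fun b => by
      by_cases hb : g b = 0
      · obtain ⟨h, hh, hvh⟩ := hw' b (by simp [hb])
        refine ⟨_, (hV b).mul hh, hvh.mono fun z hz => ?_⟩
        simp only [Pi.mul_apply, Pi.sub_apply, Pi.one_apply] at hz ⊢
        rw [hz]; ring
      · obtain ⟨h, hh, hvh⟩ := hv' b hb
        refine ⟨_, (hW b).mul hh, hvh.mono fun z hz => ?_⟩
        simp only [Pi.mul_apply, Pi.sub_apply, Pi.one_apply] at hz ⊢
        rw [hz]; ring
  exact ⟨v, w, k, hv, hw, hk, funext hk'⟩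

end HasMittagLeffler

/-! ### The Mittag-Leffler theorem over `ℂ` and `ℝ` -/

theorem exists_entire_approx {s : ℂ → ℂ} {r R ε : ℝ} (hr : 0 ≤ r) (hrR : r < R) (hε : 0 < ε)
    (hs : DifferentiableOn ℂ s (ball 0 R)) :
    ∃ p : ℂ → ℂ, Differentiable ℂ p ∧ ∀ z ∈ ball (0 : ℂ) r, ‖s z - p z‖ ≤ ε := by
  obtain ⟨R', hrR', hR'R⟩ := exists_between hrR
  lift r to NNReal using hr
  lift R' to NNReal using r.2.trans hrR'.le
  have hsR := (hs.mono (closedBall_subset_ball hR'R)).hasFPowerSeriesOnBall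
    (lt_of_le_of_lt r.2 hrR')
  have hu := hsR.tendstoUniformlyOn' (r' := r) (by exact_mod_cast hrR')
  obtain ⟨n, hn⟩ := (tendstoUniformlyOn_iff.mp hu ε hε).exists
  refine ⟨fun z => (cauchyPowerSeries s 0 R').partialSum n (z - 0), ?_,
    fun z hz => by simpa [dist_eq_norm] using (hn z hz).le⟩
  simp only [FormalMultilinearSeries.partialSum,
    FormalMultilinearSeries.apply_eq_pow_smul_coeff]
  fun_prop

/-- A series whose `n`-th term is holomorphic on the disc of radius `n + 1` converges after
subtracting entire functions from its terms. -/
theorem exists_convergence_correction {s : ℕ → ℂ → ℂ}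
    (hs : ∀ n, DifferentiableOn ℂ (s n) (ball 0 (n + 1))) :
    ∃ q : ℂ → ℂ, ∀ N : ℕ, ∃ t : ℂ → ℂ, DifferentiableOn ℂ t (ball 0 N) ∧
      ∀ z ∈ ball (0 : ℂ) N, q z = (∑ n ∈ Finset.range N, s n z) + t z := by
  choose p hp hsp using fun n : ℕ => exists_entire_approx (r := n) (R := n + 1)
    (ε := (1 / 2) ^ n) n.cast_nonneg (by linarith) (by positivity) (hs n)
  -- On the disc of radius `N`, the terms with `n ≥ N` are holomorphic and bounded by `(1 / 2) ^ n`;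
  -- only the first `N` can be singular.
  refine ⟨fun z => ∑' n, (s n z - p n z), fun N => ?_⟩
  have hu : Summable fun n : ℕ => ((1 : ℝ) / 2) ^ (n + N) :=
    (summable_nat_add_iff N).mpr summable_geometric_two
  have hle : ∀ (n : ℕ), ∀ z ∈ ball (0 : ℂ) N, ‖s (n + N) z - p (n + N) z‖ ≤ (1 / 2) ^ (n + N) :=
    fun n z hz => hsp (n + N) z
      (ball_subset_ball (by push_cast; linarith [n.cast_nonneg (α := ℝ)]) hz)
  have hd := Complex.differentiableOn_tsum_of_summable_norm
    (F := fun n z => s (n + N) z - p (n + N) z) hu (fun n => ((hs (n + N)).mono (ball_subset_ball (by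
      push_cast; linarith [n.cast_nonneg (α := ℝ)]))).sub (hp (n + N)).differentiableOn)
    isOpen_ball hle
  refine ⟨fun z => (∑' n, (s (n + N) z - p (n + N) z)) - ∑ n ∈ Finset.range N, p n z,
    hd.sub ?_, fun z hz => ?_⟩
  · exact DifferentiableOn.fun_sum fun n _ => (hp n).differentiableOn
  · have hsum : Summable fun n => s n z - p n z :=
      (summable_nat_add_iff N).mp (Summable.of_norm_bounded hu fun n => hle n z hz)
    simp only
    rw [← hsum.sum_add_tsum_nat_add N, Finset.sum_sub_distrib]
    ring

theorem hasMittagLeffler_complex : HasMittagLeffler ℂ := by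
  classical
  intro S hS T m
  set P : ℂ → ℂ → ℂ := fun b z => (T b).eval z / (z - b) ^ m b with hP
  have hPan : ∀ b z, z ≠ b → AnalyticAt ℂ (P b) z := fun b z hzb => by
    have h1 : AnalyticAt ℂ (fun z => (T b).eval z) z := (T b).differentiable.analyticAt z
    exact h1.div ((analyticAt_id.sub analyticAt_const).pow _)
      (pow_ne_zero _ (sub_ne_zero.mpr hzb))
  -- Poles are grouped by annuli `n + 1 ≤ ‖b‖ < n + 2`, so the `n`-th sum is holomorphic on the disc
  -- of radius `n + 1`. The finitely many in the open unit disc form `B` and need no correction.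
  set A : ℕ → Finset ℂ := fun n => (hS (n + 2)).toFinset.filter fun b => ⌊‖b‖⌋₊ = n + 1 with hA
  set B : Finset ℂ := (hS 1).toFinset.filter fun b => ⌊‖b‖⌋₊ = 0 with hB
  have hAmem : ∀ n b, b ∈ A n ↔ b ∈ S ∧ ⌊‖b‖⌋₊ = n + 1 := by
    intro n b
    simp only [hA, Finset.mem_filter, Set.Finite.mem_toFinset, Set.mem_inter_iff,
      mem_closedBall_zero_iff]
    refine ⟨fun h => ⟨h.1.1, h.2⟩, fun h => ⟨⟨h.1, ?_⟩, h.2⟩⟩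
    have := Nat.lt_floor_add_one ‖b‖
    rw [h.2] at this
    push_cast at this
    linarith
  have hBmem : ∀ b, b ∈ B ↔ b ∈ S ∧ ⌊‖b‖⌋₊ = 0 := by
    intro b
    simp only [hB, Finset.mem_filter, Set.Finite.mem_toFinset, Set.mem_inter_iff,
      mem_closedBall_zero_iff]
    refine ⟨fun h => ⟨h.1.1, h.2⟩, fun h => ⟨⟨h.1, ?_⟩, h.2⟩⟩
    have := Nat.lt_floor_add_one ‖b‖
    rw [h.2] at this
    push_cast at this
    linarith
  obtain ⟨q, hq⟩ := exists_convergence_correction (s := fun n z => ∑ b ∈ A n, P b z) fun n => by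
    refine DifferentiableOn.fun_sum fun b hb z hz =>
      (hPan b z ?_).differentiableAt.differentiableWithinAt
    rintro rfl
    have h1 := ((hAmem n z).mp hb).2
    have h2 := Nat.floor_le (norm_nonneg z)
    rw [h1] at h2
    rw [mem_ball_zero_iff] at hz
    push_cast at h2
    linarith
  have hloc : ∀ c : ℂ, ∃ F : Finset ℂ, (∀ b ∈ F, b ∈ S) ∧ (c ∈ S → c ∈ F) ∧ ∃ t : ℂ → ℂ,
      AnalyticAt ℂ t c ∧
        ∀ᶠ z in 𝓝 c, q z + ∑ b ∈ B, P b z = (∑ b ∈ F, P b z) + t z := by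
    intro c
    obtain ⟨t, ht, hqt⟩ := hq (⌊‖c‖⌋₊ + 1)
    have hc : ball (0 : ℂ) ((⌊‖c‖⌋₊ + 1 : ℕ) : ℝ) ∈ 𝓝 c :=
      isOpen_ball.mem_nhds (by
        rw [mem_ball_zero_iff]; push_cast; exact Nat.lt_floor_add_one _)
    refine ⟨B ∪ (Finset.range (⌊‖c‖⌋₊ + 1)).biUnion A, ?_, ?_, t, ht.analyticAt hc, ?_⟩
    · intro b hb
      simp only [Finset.mem_union, Finset.mem_biUnion, hBmem, hAmem] at hb
      rcases hb with h | ⟨n, -, h⟩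
      exacts [h.1, h.1]
    · intro hcS
      simp only [Finset.mem_union, Finset.mem_biUnion, hBmem, hAmem, Finset.mem_range]
      rcases Nat.eq_zero_or_eq_succ_pred ⌊‖c‖⌋₊ with h | h
      · exact Or.inl ⟨hcS, h⟩
      · exact Or.inr ⟨_, by omega, hcS, h⟩
    · filter_upwards [hc] with z hz
      rw [hqt z hz, Finset.sum_union, Finset.sum_biUnion]
      · ring
      · intro i _ j _ hij
        refine Finset.disjoint_left.mpr fun b hb hb' => hij ?_
        have h1 := ((hAmem i b).mp hb).2
        have h2 := ((hAmem j b).mp hb').2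
        omega
      · refine Finset.disjoint_left.mpr fun b hb hb' => ?_
        simp only [Finset.mem_biUnion, hAmem] at hb'
        obtain ⟨n, -, -, h⟩ := hb'
        have := ((hBmem b).mp hb).2
        omega
  refine ⟨fun z => q z + ∑ b ∈ B, P b z, fun c hc => ?_, fun c hc => ?_⟩
  · obtain ⟨F, hFS, -, t, ht, hqt⟩ := hloc c
    refine AnalyticAt.congr (f := fun z => (∑ b ∈ F, P b z) + t z) (AnalyticAt.add ?_ ht)
      (hqt.mono fun z hz => hz.symm)
    exact F.analyticAt_fun_sum fun b hb => hPan b c fun h => hc (h ▸ hFS b hb)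
  · obtain ⟨F, -, hcF, t, ht, hqt⟩ := hloc c
    refine AnalyticAt.congr (f := fun z => (∑ b ∈ F.erase c, P b z) + t z) (AnalyticAt.add ?_ ht)
      (hqt.mono fun z hz => ?_)
    · exact (F.erase c).analyticAt_fun_sum fun b hb => hPan b c (Finset.ne_of_mem_erase hb).symm
    · simp only
      rw [hz, ← Finset.add_sum_erase F (fun b => P b z) (hcF hc)]
      simp only [hP]
      ring

/-- The principal parts are real on the real line, so the real part of a complex solution keeps
them. -/
theorem hasMittagLeffler_real : HasMittagLeffler ℝ := by
  intro S hS T m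
  obtain ⟨q, hq, hqS⟩ := hasMittagLeffler_complex (Complex.ofReal '' S)
    (fun r => ((hS r).image Complex.ofReal).subset (by
      rintro _ ⟨⟨x, hx, rfl⟩, hxr⟩
      exact ⟨x, ⟨hx, by simpa using hxr⟩, rfl⟩))
    (fun c => (T c.re).map Complex.ofRealHom) (fun c => m c.re)
  have hre : ∀ (h : ℂ → ℂ) (b : ℝ), AnalyticAt ℂ h b → AnalyticAt ℝ (fun x : ℝ => (h x).re) b :=
    fun h b hh => hh.re_ofReal
  refine ⟨fun x => (q x).re, fun b hb => hre q b (hq b ?_), fun b hb => ?_⟩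
  · rintro ⟨x, hx, hxb⟩
    exact hb (Complex.ofReal_injective hxb ▸ hx)
  · refine (hre _ b (hqS b ⟨b, hb, rfl⟩)).congr (Eventually.of_forall fun x => ?_)
    have h1 : ((T b).map Complex.ofRealHom).eval (x : ℂ) = ((T b).eval x : ℝ) := by
      rw [Polynomial.eval_map, ← Complex.ofRealHom_eq_coe, Polynomial.eval₂_at_apply]
      rfl
    simp only [Complex.ofReal_re, h1, Complex.sub_re]
    rw [← Complex.ofReal_sub, ← Complex.ofReal_pow, ← Complex.ofReal_div, Complex.ofReal_re]

/-! ### The three rings -/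

theorem mem_complexEntire_iff {f : ℂ → ℂ} : f ∈ complexEntire ↔ ∀ z, AnalyticAt ℂ f z :=
  ⟨fun hf z => Differentiable.analyticAt hf z, fun hf z => (hf z).differentiableAt⟩

theorem differentiable_of_forall_hasSum {a : ℕ → ℂ} {f : ℂ → ℂ}
    (hf : ∀ z, HasSum (fun n => a n * z ^ n) (f z)) : Differentiable ℂ f := by
  intro c
  set r : ℝ := ‖c‖ + 1 with hr
  have hr0 : 0 ≤ r := by positivity
  -- Absolute convergence at the real point `r` majorizes the series on the disc of radius `r`.
  have hu := (hf r).summable.norm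
  have hd := Complex.differentiableOn_tsum_of_summable_norm (F := fun n z => a n * z ^ n)
    (U := ball 0 r) hu (fun n => by fun_prop) isOpen_ball (fun n w hw => by
      rw [mem_ball_zero_iff] at hw
      simp only [norm_mul, norm_pow, Complex.norm_real, Real.norm_of_nonneg hr0]
      gcongr)
  simp only [fun z => (hf z).tsum_eq] at hd
  exact hd.differentiableAt (isOpen_ball.mem_nhds (by rw [mem_ball_zero_iff]; linarith))

/-- The entire functions with real Taylor coefficients are those commuting with conjugation. -/
theorem mem_realCoeffEntire_iff {f : ℂ → ℂ} :
    f ∈ realCoeffEntire ↔ Differentiable ℂ f ∧ ∀ z, starRingEnd ℂ (f (starRingEnd ℂ z)) = f z := by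
  constructor
  · rintro ⟨a, ha⟩
    refine ⟨differentiable_of_forall_hasSum ha, fun z => ?_⟩
    refine HasSum.unique ?_ (ha z)
    simpa using (Complex.hasSum_conj'.mpr (ha (starRingEnd ℂ z)))
  · rintro ⟨hd, hc⟩
    obtain ⟨p, hp⟩ : ∃ c : ℕ → ℂ, ∀ z, HasSum (fun n => c n * z ^ n) (f z) :=
      ⟨fun n => (n.factorial : ℂ)⁻¹ * iteratedDeriv n f 0, fun z => by
        simpa [mul_assoc, mul_comm, mul_left_comm] using
          Complex.hasSum_taylorSeries_of_entire hd 0 z⟩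
    -- Averaging the series with its conjugate replaces coefficients by their real parts.
    refine ⟨fun n => (p n).re, fun z => ?_⟩
    have h1 := Complex.hasSum_conj'.mpr (hp (starRingEnd ℂ z))
    rw [hc z] at h1
    have h2 := ((hp z).add h1).mul_left (1 / 2 : ℂ)
    rw [show (1 / 2 : ℂ) * (f z + f z) = f z by ring] at h2
    refine h2.congr_fun fun n => ?_
    simp only [map_mul, map_pow, Complex.conj_conj, ← add_mul, Complex.add_conj]
    push_cast
    ring

/-- The function `z ↦ conj (f (conj z))`, obtained by conjugating Taylor coefficients. -/
def conjReflect (f : ℂ → ℂ) : ℂ → ℂ := fun z => starRingEnd ℂ (f (starRingEnd ℂ z))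

theorem Differentiable.conjReflect {f : ℂ → ℂ} (hf : Differentiable ℂ f) :
    Differentiable ℂ (conjReflect f) := fun _ =>
  differentiableAt_conj_conj_iff.mpr (hf _)

theorem conjReflect_conjReflect (f : ℂ → ℂ) : conjReflect (conjReflect f) = f := by
  funext z; simp [conjReflect]

theorem conjReflect_add (f g : ℂ → ℂ) :
    conjReflect (f + g) = conjReflect f + conjReflect g := by
  funext z; simp [conjReflect]

theorem conjReflect_sub (f g : ℂ → ℂ) :
    conjReflect (f - g) = conjReflect f - conjReflect g := by
  funext z; simp [conjReflect]

theorem conjReflect_mul (f g : ℂ → ℂ) :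
    conjReflect (f * g) = conjReflect f * conjReflect g := by
  funext z; simp [conjReflect]

theorem conjReflect_one : conjReflect 1 = 1 := by
  funext z; simp [conjReflect]

theorem mem_realCoeffEntire_iff_conjReflect {f : ℂ → ℂ} :
    f ∈ realCoeffEntire ↔ Differentiable ℂ f ∧ conjReflect f = f := by
  rw [mem_realCoeffEntire_iff, funext_iff]; rfl

theorem complexEntire_exists_dvd (f g : complexEntire) (hf : f ≠ 0) :
    ∃ v w : complexEntire, f ∣ (1 - v * g) * (1 - w * (1 - g)) := by
  obtain ⟨v, w, k, hv, hw, hk, h⟩ := hasMittagLeffler_complex.exists_dvd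
    (mem_complexEntire_iff.mp f.2) (fun h => hf (Subtype.ext h)) (mem_complexEntire_iff.mp g.2)
  exact ⟨⟨v, mem_complexEntire_iff.mpr hv⟩, ⟨w, mem_complexEntire_iff.mpr hw⟩,
    ⟨k, mem_complexEntire_iff.mpr hk⟩, Subtype.ext h⟩

theorem realAnalytic_exists_dvd (f g : realAnalytic) (hf : f ≠ 0) :
    ∃ v w : realAnalytic, f ∣ (1 - v * g) * (1 - w * (1 - g)) := by
  obtain ⟨v, w, k, hv, hw, hk, h⟩ := hasMittagLeffler_real.exists_dvd
    f.2 (fun h => hf (Subtype.ext h)) g.2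
  exact ⟨⟨v, hv⟩, ⟨w, hw⟩, ⟨k, hk⟩, Subtype.ext h⟩

theorem realCoeffEntire_exists_dvd (f g : realCoeffEntire) (hf : f ≠ 0) :
    ∃ v w : realCoeffEntire, f ∣ (1 - v * g) * (1 - w * (1 - g)) := by
  obtain ⟨f, hfm⟩ := f
  obtain ⟨g, hgm⟩ := g
  obtain ⟨hfd, hfc⟩ := mem_realCoeffEntire_iff_conjReflect.mp hfm
  obtain ⟨hgd, hgc⟩ := mem_realCoeffEntire_iff_conjReflect.mp hgm
  obtain ⟨v, w, k, hv, hw, hk, h⟩ := hasMittagLeffler_complex.exists_dvd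
    (mem_complexEntire_iff.mp hfd) (fun h => hf (Subtype.ext h)) (mem_complexEntire_iff.mp hgd)
  rw [← mem_complexEntire_iff] at hv hw hk
  have h' := congrArg conjReflect h
  simp only [conjReflect_mul, conjReflect_sub, conjReflect_one, hfc, hgc] at h'
  -- Chosen so that `1 - (u + u' - u * u' * e) * e = (1 - u * e) * (1 - u' * e)` with `u' =
  -- conjReflect u`: the product of a factor and its conjugate.
  have hnorm : ∀ u ∈ complexEntire, ∀ e ∈ realCoeffEntire,
      u + conjReflect u - u * conjReflect u * e ∈ realCoeffEntire := by
    intro u hu e he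
    obtain ⟨hed, hec⟩ := mem_realCoeffEntire_iff_conjReflect.mp he
    have hu' : conjReflect u ∈ complexEntire := Differentiable.conjReflect hu
    refine mem_realCoeffEntire_iff_conjReflect.mpr ⟨sub_mem (add_mem hu hu')
      (mul_mem (mul_mem hu hu') (show e ∈ complexEntire from hed)), ?_⟩
    simp only [conjReflect_mul, conjReflect_sub, conjReflect_add, conjReflect_conjReflect, hec]
    ring
  have hkm : f * (k * conjReflect k) ∈ realCoeffEntire := by
    have hk' : conjReflect k ∈ complexEntire := Differentiable.conjReflect hk
    refine mem_realCoeffEntire_iff_conjReflect.mpr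
      ⟨mul_mem (show f ∈ complexEntire from hfd) (mul_mem hk hk'), ?_⟩
    simp only [conjReflect_mul, conjReflect_conjReflect, hfc]
    ring
  refine ⟨⟨_, hnorm v hv g hgm⟩, ⟨_, hnorm w hw (1 - g) (sub_mem (one_mem _) hgm)⟩,
    ⟨_, hkm⟩, Subtype.ext ?_⟩
  change (1 - (v + conjReflect v - v * conjReflect v * g) * g) *
    (1 - (w + conjReflect w - w * conjReflect w * (1 - g)) * (1 - g)) =
      f * (f * (k * conjReflect k))
  linear_combination
    ((1 - conjReflect v * g) * (1 - conjReflect w * (1 - g))) * h + (f * k) * h'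

theorem proposition2p11 :
    (∀ P : Ideal complexEntire, P.IsPrime → P ≠ ⊥ →
      ∃! M : Ideal complexEntire, M.IsMaximal ∧ P ≤ M) ∧
    (∀ P : Ideal realCoeffEntire, P.IsPrime → P ≠ ⊥ →
      ∃! M : Ideal realCoeffEntire, M.IsMaximal ∧ P ≤ M) ∧
    (∀ P : Ideal realAnalytic, P.IsPrime → P ≠ ⊥ →
      ∃! M : Ideal realAnalytic, M.IsMaximal ∧ P ≤ M) :=
  ⟨existsUnique_maximal_of_forall_dvd complexEntire_exists_dvd,
    existsUnique_maximal_of_forall_dvd realCoeffEntire_exists_dvd,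
    existsUnique_maximal_of_forall_dvd realAnalytic_exists_dvd⟩
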